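/- Let $G=(V,A)$ be a finite digraph, loops allowed, i.e. $A\subseteq V\times V$; an arc $e=(u,v)$ has start-vertex $u$ and end-vertex $v$. Suppose that $G$ is 2-diregular: every vertex is the end-vertex of exactly two arcs and the start-vertex of exactly two arcs (a loop at $v$ counts as one in-arc and one out-arc of $v$). For $r\ge 1$, an alternating cycle of $G$ is a sequence $(e_0,e_1,\dots,e_{2r-1})$ of $2r$ distinct arcs such that, with indices modulo $2r$, the arcs $e_i$ and $e_{i+1}$ have a common end-vertex if $i$ is even and a common start-vertex if $i$ is odd. Alternating cycles are identified when they have the same set of arcs; let $C$ be the set of alternating cycles of $G$. (The members of $C$ partition $A$.) For $\emptyset\ne K\subseteq C$, let $G^K$ be the subgraph whose arcs are the arcs of the members of $K$ and whose vertices are the ends of these arcs. A factor of $H$, where $H=G$ or $H=G^K$, is a spanning subgraph $F$ of $H$ such that every vertex that has an out-arc in $H$ has exactly one out-arc in $F$, and every vertex that has an in-arc in $H$ has exactly one in-arc in $F$. Thus $F$ is a disjoint union of simple directed cycles (a loop being a cycle of length one) and simple directed paths. $H$ is called closed if every factor of $H$ contains a directed cycle. $G$ is called odd if every factor of $G$ has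 an odd number of cycles. $G$ is Hamiltonian if it has a simple directed cycle through all of its vertices. Theorem. Suppose that every alternating cycle of $G$ has exactly $6$ arcs and that $G$ is odd. Then $G$ is non-Hamiltonian if and only if there is a set $K$ with $\emptyset\ne K\subsetneq C$ such that $G^K$ is closed. -/

import Mathlib

namespace Digraph

variable {V : Type*}

/-- `G` is a `k`-diregular digraph: every vertex has in-degree `k` and out-degree `k`
(a loop at `v` counts once as an in-arc and once as an out-arc of `v`). -/
def IsDiregular (G : Digraph V) (k : ℕ) : Prop :=
  ∀ v : V, {u | G.Adj u v}.ncard = k ∧ {w | G.Adj v w}.ncard = k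

/-- A sequence `(e 0, …, e (2r-1))` of `2r` distinct arcs of `G` (an arc being the pair of its
start-vertex and its end-vertex) is an alternating cycle if, with indices mod `2r`, `e i` and
`e (i+1)` have a common end-vertex for even `i` and a common start-vertex for odd `i`. -/
structure IsAlternatingCycle (G : Digraph V) (r : ℕ) (e : Fin (2 * r) → V × V) : Prop where
  pos : 0 < r
  arc : ∀ i, G.Adj (e i).1 (e i).2
  distinct : Function.Injective e
  even : ∀ i : Fin (2 * r), Even (i : ℕ) → (e i).2 = (e (finRotate (2 * r) i)).2
  odd : ∀ i : Fin (2 * r), Odd (i : ℕ) → (e i).1 = (e (finRotate (2 * r) i)).1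

/-- The set of alternating cycles of `G`, each one identified with its set of arcs. -/
def alternatingCycles (G : Digraph V) : Set (Set (V × V)) :=
  {X | ∃ (r : ℕ) (e : Fin (2 * r) → V × V), G.IsAlternatingCycle r e ∧ X = Set.range e}

/-- The digraph induced by a set `K` of alternating cycles: its arcs are the arcs of the members
of `K`, and its vertices are the ends of these arcs. (Vertices of `V` without an incident arc do
not count as vertices of it; they play no role in the notions of factor and cycle below.) -/
def inducedBy (K : Set (Set (V × V))) : Digraph V where
  Adj u v := ∃ X ∈ K, (u, v) ∈ X

/-- `F` is a factor of `G`: a spanning subgraph of `G` in which every vertex with an out-arc in `G`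
has out-degree one and every vertex with an in-arc in `G` has in-degree one. So a vertex that has
both in-arcs and out-arcs in `G` has in- and out-degree one in `F`, an entry vertex of `G` has
in-degree zero and out-degree one in `F`, and an exit vertex the other way round. -/
structure IsFactor (G F : Digraph V) : Prop where
  le : F ≤ G
  out_one : ∀ v, (∃ w, G.Adj v w) → ∃! w, F.Adj v w
  in_one : ∀ v, (∃ u, G.Adj u v) → ∃! u, F.Adj u v

/-- `c` is a (simple, directed) cycle of `G`; a loop is a cycle with one vertex. `Cycle V` is the
type of lists up to rotation. -/
def IsDirectedCycle (G : Digraph V) (c : Cycle V) : Prop :=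
  c ≠ Cycle.nil ∧ c.Nodup ∧ c.Chain G.Adj

/-- The number of cycles of `F`. -/
noncomputable def index (F : Digraph V) : ℕ :=
  {c : Cycle V | F.IsDirectedCycle c}.ncard

/-- `G` is odd if each of its factors has an odd number of cycles. -/
def IsOdd (G : Digraph V) : Prop :=
  ∀ F : Digraph V, G.IsFactor F → Odd F.index

/-- `G` is closed if each of its factors contains a cycle. -/
def IsClosed (G : Digraph V) : Prop :=
  ∀ F : Digraph V, G.IsFactor F → ∃ c : Cycle V, F.IsDirectedCycle c

/-- `G` is Hamiltonian: some cycle of `G` passes through every vertex. -/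
def IsHamiltonian (G : Digraph V) : Prop :=
  ∃ c : Cycle V, G.IsDirectedCycle c ∧ ∀ v : V, v ∈ c

end Digraph

/-! The two out-arcs of a vertex lie in one alternating cycle, and so do its two in-arcs. Factors
can therefore be cut and glued one alternating cycle at a time.

If `G` is not Hamiltonian, deleting any single alternating cycle `X` leaves a closed digraph.
Otherwise take an acyclic factor of the rest and complete it by one of the two perfect matchings of
the hexagon `X`. Every cycle of the resulting permutation `σ` passes through one of the three
start-vertices of `X`, so there are at most three, and oddness leaves one or three. One is a
Hamiltonian cycle. If there are three, the other matching shifts the images of the three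
start-vertices cyclically and merges everything into one cycle (`sameCycle_of_shift`). Either way
`G` is Hamiltonian (`isHamiltonian_of_not_isClosed_inducedBy`).

Conversely, restrict a Hamiltonian cycle to the arcs of `K`. This is a factor of a closed digraph,
so it contains a cycle, which must be the whole Hamiltonian cycle. Then `K` meets, hence contains,
every alternating cycle (`IsHamiltonian.eq_alternatingCycles_of_isClosed`). -/

namespace Cycle

/-! ### Cycles as lists up to rotation, and as orbits of a map. -/

variable {α : Type*}

theorem chain_coe_iff_getElem (r : α → α → Prop) (l : List α) :
    Chain r (l : Cycle α) ↔ ∀ (i : ℕ) (hi : i < l.length),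
      r l[i] (l[(i + 1) % l.length]'(Nat.mod_lt _ (i.zero_le.trans_lt hi))) := by
  rcases l with _ | ⟨a, l⟩
  · simp
  · rw [chain_coe_cons, List.isChain_iff_getElem]
    simp only [← List.cons_append]
    constructor
    · intro h i hi
      have hi' := h i (by simp at hi ⊢; omega)
      rw [List.getElem_append_left hi] at hi'
      convert hi' using 1
      simp only [List.length_cons] at hi ⊢
      rcases Nat.lt_or_ge i l.length with h1 | h1
      · rw [List.getElem_append_left (by simp; omega)]
        simp only [Nat.mod_eq_of_lt (show i + 1 < l.length + 1 by omega)]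
      · obtain rfl : i = l.length := by omega
        simp
    · intro h i hi
      have hi1 : i < (a :: l).length := by simp at hi ⊢; omega
      have hi' := h i hi1
      rw [List.getElem_append_left hi1]
      convert hi' using 1
      simp only [List.length_cons] at hi1 ⊢
      rcases Nat.lt_or_ge i l.length with h1 | h1
      · rw [List.getElem_append_left (by simp; omega)]
        simp only [Nat.mod_eq_of_lt (show i + 1 < l.length + 1 by omega)]
      · obtain rfl : i = l.length := by omega
        simp

theorem exists_eq_coe_cons_of_mem {c : Cycle α} {x : α} (hx : x ∈ c) :
    ∃ l : List α, c = ((x :: l : List α) : Cycle α) := by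
  induction c using Quotient.inductionOn' with
  | h l =>
    obtain ⟨s, t, rfl⟩ := List.append_of_mem (show x ∈ l from hx)
    exact ⟨t ++ s, Quotient.sound' ⟨s.length, by simp⟩⟩

theorem exists_mem_of_ne_nil {c : Cycle α} (hc : c ≠ nil) : ∃ x, x ∈ c := by
  induction c using Quotient.inductionOn' with
  | h l =>
    rcases l with _ | ⟨x, l⟩
    · exact (hc rfl).elim
    · exact ⟨x, List.mem_cons_self⟩

theorem Chain.exists_mem {r : α → α → Prop} {c : Cycle α} (hc : c.Chain r) {x : α} (hx : x ∈ c) :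
    ∃ y ∈ c, r x y := by
  obtain ⟨l, rfl⟩ := exists_eq_coe_cons_of_mem hx
  exact ⟨_, by rw [mem_coe_iff]; exact List.getElem_mem _,
    (chain_coe_iff_getElem _ _).1 hc 0 (by simp)⟩

/-- Successive entries are iterates of `f`, and absence of repetition forces the length to be the
minimal period. This is what makes the cycles of a functional digraph countable by orbits. -/
theorem eq_periodicOrbit {f : α → α} {c : Cycle α} (hd : c.Nodup)
    (hc : c.Chain fun u v => f u = v) {x : α} (hx : x ∈ c) : c = Function.periodicOrbit f x := by
  obtain ⟨l, rfl⟩ := exists_eq_coe_cons_of_mem hx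
  rw [chain_coe_iff_getElem] at hc
  rw [nodup_coe_iff] at hd
  have hit : ∀ (i : ℕ) (hi : i < (x :: l).length), (x :: l)[i] = f^[i] x := by
    intro i
    induction i with
    | zero => simp
    | succ i ih =>
      intro hi
      rw [Function.iterate_succ_apply', ← ih (by omega), hc i (by omega)]
      simp only [Nat.mod_eq_of_lt hi]
  have hper : Function.IsPeriodicPt f (l.length + 1) x := by
    have := hc l.length (by simp)
    rw [hit _ (by simp), ← Function.iterate_succ_apply' (f := f)] at this
    simpa [Function.IsPeriodicPt, Function.IsFixedPt] using this
  have hmin : Function.minimalPeriod f x = l.length + 1 := by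
    refine le_antisymm (hper.minimalPeriod_le (by omega)) ?_
    by_contra hlt
    push Not at hlt
    have h0 := hit _ hlt
    rw [Function.iterate_minimalPeriod] at h0
    have := (hd.getElem_inj_iff (i := Function.minimalPeriod f x) (j := 0)
      (hi := hlt) (hj := by simp)).1 h0
    exact (hper.minimalPeriod_pos (by omega)).ne' this
  have hl : x :: l = (List.range (l.length + 1)).map fun n => f^[n] x :=
    List.ext_getElem (by simp) fun i h1 h2 => by
      rw [hit i h1, List.getElem_map, List.getElem_range]
  rw [Function.periodicOrbit_def, hmin, ← hl]

end Cycle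

/-! ### Permutations as factors: counting and merging their cycles. -/

namespace Digraph

variable {V : Type*}

/-- The functional digraph of a permutation: its arcs are the pairs `(v, σ v)`. -/
def ofPerm (σ : Equiv.Perm V) : Digraph V where
  Adj u v := σ u = v

theorem isFactor_ofPerm {G : Digraph V} {σ : Equiv.Perm V} (h : ∀ v, G.Adj v (σ v)) :
    G.IsFactor (ofPerm σ) where
  le := by
    rintro u v rfl
    exact h u
  out_one v _ := ⟨σ v, rfl, fun _ h => Eq.symm h⟩
  in_one v _ := ⟨σ.symm v, σ.apply_symm_apply v, fun _ h => (σ.symm_apply_eq.2 (Eq.symm h)).symm⟩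

section Perm

variable [Finite V] (σ : Equiv.Perm V)

theorem mem_periodicPts (v : V) : v ∈ Function.periodicPts σ :=
  Function.Injective.mem_periodicPts σ.injective v

theorem mem_periodicOrbit_iff_sameCycle {u v : V} :
    v ∈ Function.periodicOrbit σ u ↔ σ.SameCycle u v := by
  rw [Function.mem_periodicOrbit_iff (mem_periodicPts σ u)]
  constructor
  · rintro ⟨n, rfl⟩
    exact ⟨n, by rw [zpow_natCast, Equiv.Perm.coe_pow]⟩
  · intro h
    obtain ⟨n, -, hn⟩ := h.exists_pow_eq'
    exact ⟨n, by rw [← hn, Equiv.Perm.coe_pow]⟩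

theorem isDirectedCycle_periodicOrbit {H : Digraph V} {v : V}
    (h : ∀ w, σ.SameCycle v w → H.Adj w (σ w)) :
    H.IsDirectedCycle (Function.periodicOrbit σ v) := by
  refine ⟨?_, Function.nodup_periodicOrbit, ?_⟩
  · rw [Ne, Function.periodicOrbit_eq_nil_iff_not_periodic_pt, not_not]
    exact mem_periodicPts σ v
  · rw [Function.periodicOrbit_chain]
    intro n _
    rw [Function.iterate_succ_apply']
    exact h _ ((mem_periodicOrbit_iff_sameCycle σ).1
      (Function.iterate_mem_periodicOrbit (mem_periodicPts σ v) n))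

theorem index_ofPerm_eq_two {a b : V} (hab : ¬ σ.SameCycle a b)
    (h : ∀ v, σ.SameCycle a v ∨ σ.SameCycle b v) : (ofPerm σ).index = 2 := by
  have hset : {c : Cycle V | (ofPerm σ).IsDirectedCycle c} =
      {Function.periodicOrbit σ a, Function.periodicOrbit σ b} := by
    ext c
    simp only [Set.mem_ofPred_eq, Set.mem_insert_iff, Set.mem_singleton_iff]
    constructor
    · rintro ⟨hnil, hd, hc⟩
      obtain ⟨v, hv⟩ := Cycle.exists_mem_of_ne_nil hnil
      have hcv := Cycle.eq_periodicOrbit hd hc hv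
      rcases h v with hv | hv
      · left
        refine Cycle.eq_periodicOrbit hd hc ?_
        rw [hcv]
        exact (mem_periodicOrbit_iff_sameCycle σ).2 hv.symm
      · right
        refine Cycle.eq_periodicOrbit hd hc ?_
        rw [hcv]
        exact (mem_periodicOrbit_iff_sameCycle σ).2 hv.symm
    · rintro (rfl | rfl) <;> exact isDirectedCycle_periodicOrbit σ fun _ _ => rfl
  rw [index, hset, Set.ncard_pair]
  intro heq
  refine hab ((mem_periodicOrbit_iff_sameCycle σ).1 ?_)
  rw [heq]
  exact Function.self_mem_periodicOrbit (mem_periodicPts σ b)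

theorem isHamiltonian_of_sameCycle {G : Digraph V} (hG : ∀ v, G.Adj v (σ v)) {a : V}
    (h : ∀ v, σ.SameCycle a v) : G.IsHamiltonian :=
  ⟨Function.periodicOrbit σ a, isDirectedCycle_periodicOrbit σ fun w _ => hG w,
    fun v => (mem_periodicOrbit_iff_sameCycle σ).2 (h v)⟩

end Perm

theorem IsHamiltonian.exists_perm {G : Digraph V} (h : G.IsHamiltonian) :
    ∃ σ : Equiv.Perm V, (∀ v, G.Adj v (σ v)) ∧ ∀ u v, ∃ n : ℕ, σ^[n] u = v := by
  classical
  obtain ⟨c, ⟨-, hd, hc⟩, hall⟩ := h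
  induction c using Quotient.inductionOn' with
  | h l =>
    replace hd : l.Nodup := hd
    replace hall : ∀ v, v ∈ l := hall
    replace hc := (Cycle.chain_coe_iff_getElem G.Adj l).1 hc
    refine ⟨l.formPerm, fun v => ?_, fun u v => ?_⟩
    · obtain ⟨i, hi, rfl⟩ := List.getElem_of_mem (hall v)
      rw [List.formPerm_apply_getElem _ hd]
      exact hc i hi
    · obtain ⟨i, hi, rfl⟩ := List.getElem_of_mem (hall u)
      obtain ⟨j, hj, rfl⟩ := List.getElem_of_mem (hall v)
      -- `l.length - i` steps wrap around to index `0`, and `j` more reach index `j`.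
      refine ⟨j + (l.length - i), ?_⟩
      rw [← Equiv.Perm.coe_pow, List.formPerm_pow_apply_getElem _ hd]
      congr 1
      rw [show i + (j + (l.length - i)) = j + l.length by omega, Nat.add_mod_right,
        Nat.mod_eq_of_lt hj]

/-- If each of `a`, `b`, `c` lies in its own cycle of `σ` and there is no other cycle, then a
permutation that agrees with `σ` up to a cyclic shift of the images of `a`, `b`, `c` is a single
cycle. -/
theorem sameCycle_of_shift [Finite V] {σ τ : Equiv.Perm V} {a b c : V}
    (hab : ¬ σ.SameCycle a b) (hac : ¬ σ.SameCycle a c) (hbc : ¬ σ.SameCycle b c)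
    (hall : ∀ v, σ.SameCycle a v ∨ σ.SameCycle b v ∨ σ.SameCycle c v)
    (ha : τ a = σ c) (hb : τ b = σ a) (hc : τ c = σ b)
    (hτ : ∀ v, v ≠ a → v ≠ b → v ≠ c → τ v = σ v) (v : V) : τ.SameCycle a v := by
  -- From `q`, `τ` enters the `σ`-cycle of `p` just after `p` and follows it until it reaches `p`
  -- itself.
  have key : ∀ p q : V, τ q = σ p → (∀ w, σ.SameCycle p w → w ≠ p → τ w = σ w) →
      ∀ w, σ.SameCycle p w → τ.SameCycle q w := by
    intro p q hpq hp w hw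
    obtain ⟨n, hn, -, rfl⟩ := hw.exists_pow_eq''
    clear hw
    induction n, hn using Nat.le_induction with
    | base =>
      rw [pow_one, ← hpq, Equiv.Perm.sameCycle_apply_right]
    | succ n hn ih =>
      rw [pow_succ', Equiv.Perm.mul_apply]
      by_cases h : (σ ^ n) p = p
      · rw [h, ← hpq, Equiv.Perm.sameCycle_apply_right]
      · rw [← hp _ ⟨n, by simp⟩ h, Equiv.Perm.sameCycle_apply_right]
        exact ih
  have kc := key c a ha fun w hw h => hτ w
    (by rintro rfl; exact hac hw.symm) (by rintro rfl; exact hbc hw.symm) h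
  have ka := key a b hb fun w hw h => hτ w h
    (by rintro rfl; exact hab hw) (by rintro rfl; exact hac hw)
  have kb := key b c hc fun w hw h => hτ w
    (by rintro rfl; exact hab hw.symm) h (by rintro rfl; exact hbc hw)
  have hac' := kc c (.refl _ _)
  have hab' := hac'.trans (kb b (.refl _ _))
  rcases hall v with h | h | h
  · exact hab'.trans (ka v h)
  · exact hac'.trans (kb v h)
  · exact kc v h

end Digraph
-- Every arc lies on an alternating cycle.
/-- Alternating application of two functions: the sequence `a, α a, β (α a), α (β (α a)), …`. -/
def alternatingSeq {A : Type*} (α β : A → A) (a : A) : ℕ → A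
  | 0 => a
  | n + 1 => if Even n then α (alternatingSeq α β a n) else β (alternatingSeq α β a n)

/-- At the first repetition `s i = s (j + 1)`, the involution joining `s j` to `s (j + 1)` can be
applied to `s i`. Unless `i = 0` and `j + 1` is even, this yields an earlier repetition or a fixed
point. -/
theorem exists_alternatingSeq_period {A : Type*} [Finite A] {α β : A → A}
    (hα : Function.Involutive α) (hβ : Function.Involutive β)
    (hα' : ∀ x, α x ≠ x) (hβ' : ∀ x, β x ≠ x) (a : A) :
    ∃ r, 0 < r ∧ alternatingSeq α β a (2 * r) = a ∧
      ∀ i j, i < j → j < 2 * r → alternatingSeq α β a i ≠ alternatingSeq α β a j := by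
  classical
  set s := alternatingSeq α β a with hs
  have hse : ∀ n, Even n → s (n + 1) = α (s n) := fun n hn => by simp [hs, alternatingSeq, hn]
  have hso : ∀ n, ¬ Even n → s (n + 1) = β (s n) := fun n hn => by simp [hs, alternatingSeq, hn]
  have hex : ∃ j, ∃ i < j, s i = s j := by
    obtain ⟨i, j, hij, h⟩ := Finite.exists_ne_map_eq_of_infinite s
    rcases hij.lt_or_gt with h1 | h1
    · exact ⟨j, i, h1, h⟩
    · exact ⟨i, j, h1, h.symm⟩
  obtain ⟨i, hij, h⟩ := Nat.find_spec hex
  have hmin : ∀ j < Nat.find hex, ∀ i < j, s i ≠ s j := fun j hj i hi h =>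
    Nat.find_min hex hj ⟨i, hi, h⟩
  generalize Nat.find hex = j at hij h hmin
  obtain ⟨j, rfl⟩ : ∃ k, j = k + 1 := ⟨j - 1, by omega⟩
  -- With equal parities that involution is the step forward from `s i`, so `s (i + 1) = s j`;
  -- otherwise, for `i > 0`, it is the step back.
  by_cases hpar : Even i ↔ Even j
  · exfalso
    have h1 : s (i + 1) = s j := by
      by_cases hi : Even i
      · rw [hse i hi, h, hse j (hpar.1 hi), hα]
      · rw [hso i hi, h, hso j (hpar.not.1 hi), hβ]
    rcases (show i ≤ j by omega).eq_or_lt with rfl | hlt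
    · by_cases hi : Even i
      · exact hα' (s i) (by rw [← hse i hi, ← h])
      · exact hβ' (s i) (by rw [← hso i hi, ← h])
    · have hne : i + 1 ≠ j := by
        rintro rfl
        rw [Nat.even_add_one] at hpar
        tauto
      exact hmin j (by omega) (i + 1) (by omega) h1
  · rcases i with _ | i
    · have hj : Even (j + 1) := by
        simp only [Even.zero, true_iff] at hpar
        exact Nat.even_add_one.2 hpar
      obtain ⟨r, hr⟩ := hj
      refine ⟨r, by omega, ?_, fun i k hik hk => hmin k (by omega) i hik⟩
      rw [show 2 * r = j + 1 by omega, ← h]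
      rfl
    · exfalso
      have h1 : s i = s j := by
        by_cases hi : Even i
        · have hj : Even j := by
            by_contra hj
            exact hpar (by simp [Nat.even_add_one, hi, hj])
          rw [hse i hi, hse j hj] at h
          exact hα.injective h
        · have hj : ¬ Even j := by
            intro hj
            exact hpar (by simp [Nat.even_add_one, hi, hj])
          rw [hso i hi, hso j hj] at h
          exact hβ.injective h
      exact hmin j (by omega) i (by omega) h1

theorem coe_finRotate_eq_mod {n : ℕ} (i : Fin n) : (finRotate n i : ℕ) = (i + 1) % n := by
  have := i.neZero
  rw [finRotate_apply, Fin.val_add, Fin.val_one', Nat.add_mod_mod]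

namespace Digraph

variable {V : Type*} {G : Digraph V}

theorem IsDiregular.eq_of_out [Finite V] (h : G.IsDiregular 2) {v a b w : V} (ha : G.Adj v a)
    (hb : G.Adj v b) (hab : a ≠ b) (hw : G.Adj v w) : w = a ∨ w = b := by
  have hsub : ({a, b} : Set V) ⊆ {w | G.Adj v w} := by
    rintro x (rfl | rfl) <;> assumption
  have := Set.eq_of_subset_of_ncard_le hsub (by rw [(h v).2, Set.ncard_pair hab])
  have hw' : w ∈ {w | G.Adj v w} := hw
  rw [← this] at hw'
  exact hw'

theorem IsDiregular.eq_of_in [Finite V] (h : G.IsDiregular 2) {v a b w : V} (ha : G.Adj a v)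
    (hb : G.Adj b v) (hab : a ≠ b) (hw : G.Adj w v) : w = a ∨ w = b := by
  have hsub : ({a, b} : Set V) ⊆ {w | G.Adj w v} := by
    rintro x (rfl | rfl) <;> assumption
  have := Set.eq_of_subset_of_ncard_le hsub (by rw [(h v).1, Set.ncard_pair hab])
  have hw' : w ∈ {w | G.Adj w v} := hw
  rw [← this] at hw'
  exact hw'

theorem IsDiregular.exists_ne_out (h : G.IsDiregular 2) (v a : V) : ∃ b, G.Adj v b ∧ b ≠ a :=
  Set.exists_ne_of_one_lt_ncard (s := {w | G.Adj v w}) (by rw [(h v).2]; omega) a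

theorem IsDiregular.exists_ne_in (h : G.IsDiregular 2) (v a : V) : ∃ b, G.Adj b v ∧ b ≠ a :=
  Set.exists_ne_of_one_lt_ncard (s := {u | G.Adj u v}) (by rw [(h v).1]; omega) a

theorem IsDiregular.exists_alternatingCycle_mem [Finite V] (h : G.IsDiregular 2) {u v : V}
    (huv : G.Adj u v) : ∃ X ∈ G.alternatingCycles, (u, v) ∈ X := by
  choose o ho ho' using h.exists_ne_out
  choose i hi hi' using h.exists_ne_in
  let A := {p : V × V // G.Adj p.1 p.2}
  let α : A → A := fun p => ⟨(i p.1.2 p.1.1, p.1.2), hi _ _⟩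
  let β : A → A := fun p => ⟨(p.1.1, o p.1.1 p.1.2), ho _ _⟩
  have hα : Function.Involutive α := fun p => by
    refine Subtype.ext (Prod.ext ?_ rfl)
    exact ((h.eq_of_in p.2 (hi p.1.2 p.1.1) (hi' _ _).symm (hi _ _)).resolve_right (hi' _ _))
  have hβ : Function.Involutive β := fun p => by
    refine Subtype.ext (Prod.ext rfl ?_)
    exact ((h.eq_of_out p.2 (ho p.1.1 p.1.2) (ho' _ _).symm (ho _ _)).resolve_right (ho' _ _))
  have hα' : ∀ p, α p ≠ p := fun p hp => hi' p.1.2 p.1.1 (congrArg (fun q : A => q.1.1) hp)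
  have hβ' : ∀ p, β p ≠ p := fun p hp => ho' p.1.1 p.1.2 (congrArg (fun q : A => q.1.2) hp)
  obtain ⟨r, hr, hper, hinj⟩ := exists_alternatingSeq_period hα hβ hα' hβ' ⟨(u, v), huv⟩
  set s := alternatingSeq α β ⟨(u, v), huv⟩ with hs
  have hmod : ∀ j : Fin (2 * r), s (finRotate (2 * r) j) = s (j + 1) := by
    intro j
    rw [coe_finRotate_eq_mod]
    rcases (show (j : ℕ) + 1 ≤ 2 * r from j.2).eq_or_lt with hj | hj
    · rw [hj, Nat.mod_self, hper]
      rfl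
    · rw [Nat.mod_eq_of_lt hj]
  refine ⟨_, ⟨r, fun j => (s j).1, ⟨hr, fun j => (s j).2, ?_, ?_, ?_⟩, rfl⟩, ⟨0, by omega⟩, rfl⟩
  · intro j k hjk
    have hjk' : s j = s k := Subtype.ext hjk
    rcases lt_trichotomy (j : ℕ) k with hlt | heq | hlt
    · exact (hinj _ _ hlt k.2 hjk').elim
    · exact Fin.ext heq
    · exact (hinj _ _ hlt j.2 hjk'.symm).elim
  · intro j hj
    simp only [hmod]
    simp [hs, alternatingSeq, hj, α]
  · intro j hj
    simp only [hmod]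
    simp [hs, alternatingSeq, Nat.not_even_iff_odd.2 hj, β]

/-! ### Alternating cycles partition the arcs; the hexagon. -/

namespace IsAlternatingCycle

variable {r : ℕ} {e : Fin (2 * r) → V × V}

theorem finRotate_ne (h : G.IsAlternatingCycle r e) (i : Fin (2 * r)) :
    finRotate (2 * r) i ≠ i := by
  intro hi
  have h1 := congrArg Fin.val hi
  rw [coe_finRotate_eq_mod] at h1
  have := i.2
  have := h.pos
  rcases (show (i : ℕ) + 1 ≤ 2 * r from i.2).eq_or_lt with hj | hj
  · rw [hj, Nat.mod_self] at h1
    omega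
  · rw [Nat.mod_eq_of_lt hj] at h1
    omega

theorem even_finRotate (i : Fin (2 * r)) :
    Even (finRotate (2 * r) i : ℕ) ↔ ¬ Even (i : ℕ) := by
  rw [coe_finRotate_eq_mod, ← Nat.even_add_one, Nat.even_iff, Nat.even_iff,
    Nat.mod_mod_of_dvd _ (dvd_mul_right 2 r)]

/-- An arc already shares its end-vertex with a cyclic neighbour, the next arc for even index and
the previous one for odd; in-degree two leaves no room for a third. -/
theorem mem_range_of_snd_eq [Finite V] (h : G.IsAlternatingCycle r e) (hG : G.IsDiregular 2)
    {u v w : V} (hu : (u, v) ∈ Set.range e) (hw : G.Adj w v) : (w, v) ∈ Set.range e := by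
  obtain ⟨i, hi⟩ := hu
  obtain ⟨j, hj, hji⟩ : ∃ j, j ≠ i ∧ (e j).2 = (e i).2 := by
    by_cases hie : Even (i : ℕ)
    · exact ⟨_, h.finRotate_ne i, (h.even i hie).symm⟩
    · obtain ⟨k, rfl⟩ := (finRotate (2 * r)).surjective i
      rw [even_finRotate, not_not] at hie
      exact ⟨k, (h.finRotate_ne k).symm, h.even k hie⟩
  have hne : (e j).1 ≠ (e i).1 := fun h1 => hj (h.distinct (Prod.ext h1 hji))
  have ai := h.arc i
  have aj := h.arc j
  rw [hji] at aj
  rw [show v = (e i).2 by rw [hi]] at hw ⊢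
  rcases hG.eq_of_in aj ai hne hw with rfl | rfl
  · exact ⟨j, Prod.ext rfl hji⟩
  · exact ⟨i, rfl⟩

theorem mem_range_of_fst_eq [Finite V] (h : G.IsAlternatingCycle r e) (hG : G.IsDiregular 2)
    {u v w : V} (hu : (u, v) ∈ Set.range e) (hw : G.Adj u w) : (u, w) ∈ Set.range e := by
  obtain ⟨i, hi⟩ := hu
  obtain ⟨j, hj, hji⟩ : ∃ j, j ≠ i ∧ (e j).1 = (e i).1 := by
    by_cases hie : Even (i : ℕ)
    · obtain ⟨k, rfl⟩ := (finRotate (2 * r)).surjective i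
      rw [even_finRotate, Nat.not_even_iff_odd] at hie
      exact ⟨k, (h.finRotate_ne k).symm, h.odd k hie⟩
    · exact ⟨_, h.finRotate_ne i, (h.odd i (Nat.not_even_iff_odd.1 hie)).symm⟩
  have hne : (e j).2 ≠ (e i).2 := fun h1 => hj (h.distinct (Prod.ext hji h1))
  have ai := h.arc i
  have aj := h.arc j
  rw [hji] at aj
  rw [show u = (e i).1 by rw [hi]] at hw ⊢
  rcases hG.eq_of_out aj ai hne hw with rfl | rfl
  · exact ⟨j, Prod.ext hji rfl⟩
  · exact ⟨i, rfl⟩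

end IsAlternatingCycle

section

variable {X Y : Set (V × V)}

theorem adj_of_mem_alternatingCycle (hX : X ∈ G.alternatingCycles) {u v : V} (h : (u, v) ∈ X) :
    G.Adj u v := by
  obtain ⟨r, e, he, rfl⟩ := hX
  obtain ⟨i, hi⟩ := h
  have := he.arc i
  rwa [hi] at this

theorem mem_alternatingCycle_of_in [Finite V] (hG : G.IsDiregular 2)
    (hX : X ∈ G.alternatingCycles) {u v w : V} (hu : (u, v) ∈ X) (hw : G.Adj w v) :
    (w, v) ∈ X := by
  obtain ⟨r, e, he, rfl⟩ := hX
  exact he.mem_range_of_snd_eq hG hu hw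

theorem mem_alternatingCycle_of_out [Finite V] (hG : G.IsDiregular 2)
    (hX : X ∈ G.alternatingCycles) {u v w : V} (hu : (u, v) ∈ X) (hw : G.Adj u w) :
    (u, w) ∈ X := by
  obtain ⟨r, e, he, rfl⟩ := hX
  exact he.mem_range_of_fst_eq hG hu hw

/-- Consecutive arcs of `X` share an end, and `Y` absorbs all arcs sharing the corresponding end, so
membership in `Y` propagates around `X`. -/
theorem alternatingCycle_subset [Finite V] (hG : G.IsDiregular 2)
    (hX : X ∈ G.alternatingCycles) (hY : Y ∈ G.alternatingCycles) {a : V × V} (haX : a ∈ X)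
    (haY : a ∈ Y) : X ⊆ Y := by
  obtain ⟨r, e, he, rfl⟩ := hX
  obtain ⟨j, rfl⟩ := haX
  have hrot : ∀ i, e i ∈ Y → e (finRotate (2 * r) i) ∈ Y := by
    intro i hi
    have ha := he.arc (finRotate (2 * r) i)
    by_cases hie : Even (i : ℕ)
    · rw [← he.even i hie] at ha
      have := mem_alternatingCycle_of_in hG hY hi ha
      rwa [he.even i hie] at this
    · have hio := Nat.not_even_iff_odd.1 hie
      rw [← he.odd i hio] at ha
      have := mem_alternatingCycle_of_out hG hY hi ha
      rwa [he.odd i hio] at this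
  have hit : ∀ n : ℕ, ∀ hn : (j + n) % (2 * r) < 2 * r, e ⟨(j + n) % (2 * r), hn⟩ ∈ Y := by
    intro n
    induction n with
    | zero =>
      intro hn
      convert haY
      exact Nat.mod_eq_of_lt j.2
    | succ n ih =>
      intro hn
      have := hrot _ (ih (Nat.mod_lt _ (by omega)))
      convert this using 2
      refine Fin.ext ?_
      rw [coe_finRotate_eq_mod, Nat.mod_add_mod, add_assoc]
  rintro _ ⟨i, rfl⟩
  have hi := hit (i + (2 * r - j)) (Nat.mod_lt _ i.pos)
  convert hi using 2
  refine Fin.ext ?_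
  change (i : ℕ) = (j + (i + (2 * r - j))) % (2 * r)
  rw [show (j : ℕ) + (i + (2 * r - j)) = i + 2 * r by omega, Nat.add_mod_right,
    Nat.mod_eq_of_lt i.2]

theorem alternatingCycle_eq [Finite V] (hG : G.IsDiregular 2)
    (hX : X ∈ G.alternatingCycles) (hY : Y ∈ G.alternatingCycles) {a : V × V} (haX : a ∈ X)
    (haY : a ∈ Y) : X = Y :=
  (alternatingCycle_subset hG hX hY haX haY).antisymm (alternatingCycle_subset hG hY hX haY haX)

theorem alternatingCycle_nonempty (hX : X ∈ G.alternatingCycles) : X.Nonempty := by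
  obtain ⟨r, e, he, rfl⟩ := hX
  have := he.pos
  exact ⟨_, ⟨0, by omega⟩, rfl⟩

/-- An alternating cycle with six arcs joins three start-vertices to three end-vertices. -/
theorem exists_hexagon [Finite V] (hG : G.IsDiregular 2) (hX : X ∈ G.alternatingCycles)
    (h6 : X.ncard = 6) :
    ∃ x y : Fin 3 → V, Function.Injective x ∧ Function.Injective y ∧
      (∀ i, (x i, y i) ∈ X ∧ (x i, y (i - 1)) ∈ X) ∧ ∀ u v, (u, v) ∈ X → ∃ i, x i = u := by
  obtain ⟨r, e, he, rfl⟩ := hX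
  rw [← Set.image_univ, Set.ncard_image_of_injective _ he.distinct, Set.ncard_univ,
    Nat.card_fin] at h6
  obtain rfl : r = 3 := by omega
  have rot : ∀ i : Fin 6, finRotate (2 * 3) i = i + 1 := by decide
  have h01 : (e 0).2 = (e 1).2 := by simpa [rot] using he.even 0 (by decide)
  have h12 : (e 1).1 = (e 2).1 := by simpa [rot] using he.odd 1 (by decide)
  have h23 : (e 2).2 = (e 3).2 := by simpa [rot] using he.even 2 (by decide)
  have h34 : (e 3).1 = (e 4).1 := by simpa [rot] using he.odd 3 (by decide)
  have h45 : (e 4).2 = (e 5).2 := by simpa [rot] using he.even 4 (by decide)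
  have h50 : (e 5).1 = (e 0).1 := by simpa [rot] using he.odd 5 (by decide)
  -- Three distinct arcs with a common start-vertex would exceed out-degree two.
  have out : ∀ i j k : Fin 6, i ≠ j → i ≠ k → j ≠ k → (e i).1 = (e j).1 → (e i).1 ≠ (e k).1 := by
    intro i j k hij hik hjk h1 h2
    have aj := he.arc j
    have ak := he.arc k
    rw [← h1] at aj
    rw [← h2] at ak
    rcases hG.eq_of_out (he.arc i) aj (fun h => hij (he.distinct (Prod.ext h1 h))) ak with h | h
    · exact hik (he.distinct (Prod.ext h2 h.symm))
    · exact hjk (he.distinct (Prod.ext (h1.symm.trans h2) h.symm))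
  have inn : ∀ i j k : Fin 6, i ≠ j → i ≠ k → j ≠ k → (e i).2 = (e j).2 → (e i).2 ≠ (e k).2 := by
    intro i j k hij hik hjk h1 h2
    have aj := he.arc j
    have ak := he.arc k
    rw [← h1] at aj
    rw [← h2] at ak
    rcases hG.eq_of_in (he.arc i) aj (fun h => hij (he.distinct (Prod.ext h h1))) ak with h | h
    · exact hik (he.distinct (Prod.ext h.symm h2))
    · exact hjk (he.distinct (Prod.ext h.symm (h1.symm.trans h2)))
  have x01 : (e 0).1 ≠ (e 2).1 := out 0 5 2 (by decide) (by decide) (by decide) h50.symm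
  have x12 : (e 2).1 ≠ (e 4).1 := out 2 1 4 (by decide) (by decide) (by decide) h12.symm
  have x02 : (e 0).1 ≠ (e 4).1 := out 0 5 4 (by decide) (by decide) (by decide) h50.symm
  have y01 : (e 0).2 ≠ (e 2).2 := inn 0 1 2 (by decide) (by decide) (by decide) h01
  have y12 : (e 2).2 ≠ (e 4).2 := inn 2 3 4 (by decide) (by decide) (by decide) h23
  have y02 : (e 0).2 ≠ (e 4).2 := inn 0 1 4 (by decide) (by decide) (by decide) h01
  refine ⟨![(e 0).1, (e 2).1, (e 4).1], ![(e 0).2, (e 2).2, (e 4).2], ?_, ?_, ?_, ?_⟩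
  · intro i j
    fin_cases i <;> fin_cases j <;> simp [x01, x12, x02, x01.symm, x12.symm, x02.symm]
  · intro i j
    fin_cases i <;> fin_cases j <;> simp [y01, y12, y02, y01.symm, y12.symm, y02.symm]
  · intro i
    fin_cases i
    · exact ⟨⟨0, rfl⟩, ⟨5, Prod.ext h50 h45.symm⟩⟩
    · exact ⟨⟨2, rfl⟩, ⟨1, Prod.ext h12 h01.symm⟩⟩
    · exact ⟨⟨4, rfl⟩, ⟨3, Prod.ext h34 h23.symm⟩⟩
  · rintro u v ⟨i, hi⟩
    obtain rfl : (e i).1 = u := by rw [hi]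
    change Fin 6 at i
    fin_cases i
    exacts [⟨0, rfl⟩, ⟨1, h12.symm⟩, ⟨1, rfl⟩, ⟨2, h34.symm⟩, ⟨2, rfl⟩, ⟨0, h50.symm⟩]

end

end Digraph
-- The two directions of the equivalence.
namespace Digraph

variable {V : Type*} {G : Digraph V} {X : Set (V × V)}

/-- A factor of the digraph induced by all alternating cycles but `X`, together with a perfect
matching of `X`, is the functional digraph of a permutation. -/
theorem exists_perm_of_isFactor_inducedBy [Finite V] (hG : G.IsDiregular 2)
    (hX : X ∈ G.alternatingCycles) {F : Digraph V}
    (hF : (inducedBy (G.alternatingCycles \ {X})).IsFactor F) {ι : Type*} {x y : ι → V}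
    (hx : Function.Injective x) (hy : Function.Injective y) (hxy : ∀ i, (x i, y i) ∈ X)
    (hsrc : ∀ u v, (u, v) ∈ X → ∃ i, x i = u) :
    ∃ σ : Equiv.Perm V, (∀ i, σ (x i) = y i) ∧ (∀ v, (∀ i, x i ≠ v) → F.Adj v (σ v)) ∧
      ∀ v, G.Adj v (σ v) := by
  classical
  have hex : ∀ v, ∃ w, (∀ i, x i = v → w = y i) ∧ ((∀ i, x i ≠ v) → F.Adj v w) := by
    intro v
    by_cases hv : ∃ i, x i = v
    · obtain ⟨i, rfl⟩ := hv
      exact ⟨y i, fun j hj => by rw [hx hj], fun h => (h i rfl).elim⟩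
    · push Not at hv
      obtain ⟨w, hw, -⟩ := hG.exists_ne_out v v
      obtain ⟨Y, hY, hvY⟩ := hG.exists_alternatingCycle_mem hw
      have hYX : Y ≠ X := by
        rintro rfl
        obtain ⟨i, hi⟩ := hsrc _ _ hvY
        exact hv i hi
      obtain ⟨w', hw', -⟩ := hF.out_one v ⟨w, Y, ⟨hY, hYX⟩, hvY⟩
      exact ⟨w', fun i hi => (hv i hi).elim, fun _ => hw'⟩
  choose f hf₁ hf₂ using hex
  -- All arcs into `y i` belong to `X`, so they start at some `x j`.
  have key : ∀ i v, (∀ j, x j ≠ v) → f (x i) ≠ f v := by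
    intro i v hv heq
    rw [hf₁ (x i) i rfl] at heq
    obtain ⟨Y, ⟨hY, hYX⟩, hvY⟩ := hF.le (hf₂ v hv)
    rw [← heq] at hvY
    obtain ⟨j, hj⟩ := hsrc _ _
      (mem_alternatingCycle_of_in hG hX (hxy i) (adj_of_mem_alternatingCycle hY hvY))
    exact hv j hj
  have hinj : Function.Injective f := by
    intro u v huv
    by_cases hu : ∃ i, x i = u <;> by_cases hv : ∃ i, x i = v
    · obtain ⟨i, rfl⟩ := hu
      obtain ⟨j, rfl⟩ := hv
      rw [hf₁ _ i rfl, hf₁ _ j rfl] at huv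
      rw [hy huv]
    · obtain ⟨i, rfl⟩ := hu
      push Not at hv
      exact (key i v hv huv).elim
    · obtain ⟨j, rfl⟩ := hv
      push Not at hu
      exact (key j u hu huv.symm).elim
    · push Not at hu hv
      have hu' := hf₂ u hu
      have hv' := hf₂ v hv
      rw [huv] at hu'
      exact (hF.in_one (f v) ⟨v, hF.le hv'⟩).unique hu' hv'
  refine ⟨Equiv.ofBijective f (Finite.injective_iff_bijective.1 hinj), fun i => hf₁ _ i rfl,
    hf₂, fun v => ?_⟩
  change G.Adj v (f v)
  by_cases hv : ∃ i, x i = v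
  · obtain ⟨i, rfl⟩ := hv
    rw [hf₁ _ i rfl]
    exact adj_of_mem_alternatingCycle hX (hxy i)
  · push Not at hv
    obtain ⟨Y, hY, hvY⟩ := hF.le (hf₂ v hv)
    exact adj_of_mem_alternatingCycle hY.1 hvY

theorem isHamiltonian_of_not_isClosed_inducedBy [Finite V] (hG : G.IsDiregular 2)
    (hodd : G.IsOdd) (hX : X ∈ G.alternatingCycles) (h6 : X.ncard = 6)
    (hcl : ¬ (inducedBy (G.alternatingCycles \ {X})).IsClosed) : G.IsHamiltonian := by
  simp only [IsClosed, not_forall, exists_prop] at hcl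
  obtain ⟨F, hF, hacyc⟩ := hcl
  obtain ⟨x, y, hx, hy, hxy, hsrc⟩ := exists_hexagon hG hX h6
  obtain ⟨σ, hσ, hσF, hσG⟩ :=
    exists_perm_of_isFactor_inducedBy hG hX hF hx hy (fun i => (hxy i).1) hsrc
  obtain ⟨τ, hτ, hτF, hτG⟩ :=
    exists_perm_of_isFactor_inducedBy hG hX hF hx (y := fun i => y (i - 1))
      (hy.comp (sub_left_injective)) (fun i => (hxy i).2) hsrc
  -- A `σ`-cycle avoiding every `x i` would be a cycle of the acyclic `F`.
  have hcov : ∀ v, ∃ i, σ.SameCycle (x i) v := by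
    intro v
    by_contra! hv
    refine hacyc ⟨_, isDirectedCycle_periodicOrbit σ (v := v) fun w hw => hσF w fun i hi => ?_⟩
    exact hv i (hi ▸ hw.symm)
  have hcov3 : ∀ v, σ.SameCycle (x 0) v ∨ σ.SameCycle (x 1) v ∨ σ.SameCycle (x 2) v := by
    intro v
    obtain ⟨i, hi⟩ := hcov v
    fin_cases i
    exacts [.inl hi, .inr (.inl hi), .inr (.inr hi)]
  -- Oddness enters only here: `σ` is a factor of `G`, so it cannot have exactly two cycles.
  have hpar : ∀ a b, ¬ σ.SameCycle a b → ¬ ∀ v, σ.SameCycle a v ∨ σ.SameCycle b v := by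
    intro a b hab h
    have := hodd _ (isFactor_ofPerm hσG)
    rw [index_ofPerm_eq_two σ hab h] at this
    exact absurd this (by decide)
  by_cases h01 : σ.SameCycle (x 0) (x 1)
  · have h : ∀ v, σ.SameCycle (x 0) v ∨ σ.SameCycle (x 2) v := fun v => by
      rcases hcov3 v with h | h | h
      exacts [.inl h, .inl (h01.trans h), .inr h]
    have h02 : σ.SameCycle (x 0) (x 2) := by
      by_contra h02
      exact hpar _ _ h02 h
    exact isHamiltonian_of_sameCycle σ hσG fun v => (h v).elim id h02.trans
  · have h02 : ¬ σ.SameCycle (x 0) (x 2) := fun h02 => hpar _ _ h01 fun v => by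
      rcases hcov3 v with h | h | h
      exacts [.inl h, .inr h, .inl (h02.trans h)]
    have h12 : ¬ σ.SameCycle (x 1) (x 2) := fun h12 => hpar _ _ h01 fun v => by
      rcases hcov3 v with h | h | h
      exacts [.inl h, .inr h, .inr (h12.trans h)]
    refine isHamiltonian_of_sameCycle τ hτG (sameCycle_of_shift h01 h02 h12 hcov3
      (by rw [hτ, hσ]; rfl) (by rw [hτ, hσ]; rfl) (by rw [hτ, hσ]; rfl) fun v h0 h1 h2 => ?_)
    have hv : ∀ i, x i ≠ v := by
      intro i
      fin_cases i
      exacts [h0.symm, h1.symm, h2.symm]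
    exact (hF.out_one v ⟨_, hF.le (hσF v hv)⟩).unique (hτF v hv) (hσF v hv)

/-- The restriction of a factor of `G` to the arcs of some alternating cycles of `G`. -/
theorem IsFactor.inf_inducedBy [Finite V] (hG : G.IsDiregular 2) {F : Digraph V}
    (hF : G.IsFactor F) {K : Set (Set (V × V))} (hK : K ⊆ G.alternatingCycles) :
    (inducedBy K).IsFactor (F ⊓ inducedBy K) where
  le := inf_le_right
  out_one := by
    rintro v ⟨w, X, hX, hvw⟩
    obtain ⟨w', hw', huniq⟩ := hF.out_one v ⟨w, adj_of_mem_alternatingCycle (hK hX) hvw⟩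
    exact ⟨w', ⟨hw', X, hX, mem_alternatingCycle_of_out hG (hK hX) hvw (hF.le hw')⟩,
      fun z hz => huniq z hz.1⟩
  in_one := by
    rintro v ⟨w, X, hX, hvw⟩
    obtain ⟨w', hw', huniq⟩ := hF.in_one v ⟨w, adj_of_mem_alternatingCycle (hK hX) hvw⟩
    exact ⟨w', ⟨hw', X, hX, mem_alternatingCycle_of_in hG (hK hX) hvw (hF.le hw')⟩,
      fun z hz => huniq z hz.1⟩

theorem IsHamiltonian.eq_alternatingCycles_of_isClosed [Finite V] (hG : G.IsDiregular 2)
    (hham : G.IsHamiltonian) {K : Set (Set (V × V))} (hK : K ⊆ G.alternatingCycles)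
    (hcl : (inducedBy K).IsClosed) : K = G.alternatingCycles := by
  obtain ⟨σ, hσG, hσ⟩ := hham.exists_perm
  obtain ⟨c, hnil, -, hc⟩ := hcl _ ((isFactor_ofPerm hσG).inf_inducedBy hG hK)
  -- The cycle `c` is closed under `σ`, which is transitive, so `c` covers `V` and every arc `(v, σ
  -- v)` lies in a member of `K`.
  have step : ∀ v ∈ c, σ v ∈ c ∧ (inducedBy K).Adj v (σ v) := by
    intro v hv
    obtain ⟨w, hw, h1, h2⟩ := hc.exists_mem hv
    obtain rfl : σ v = w := h1
    exact ⟨hw, h2⟩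
  obtain ⟨u, hu⟩ := Cycle.exists_mem_of_ne_nil hnil
  have hall : ∀ v, v ∈ c := by
    intro v
    obtain ⟨n, rfl⟩ := hσ u v
    induction n with
    | zero => exact hu
    | succ n ih =>
      rw [Function.iterate_succ_apply']
      exact (step _ ih).1
  refine hK.antisymm fun X hX => ?_
  obtain ⟨⟨v, w⟩, hvw⟩ := alternatingCycle_nonempty hX
  have hvX := mem_alternatingCycle_of_out hG hX hvw (hσG v)
  obtain ⟨Y, hY, hvY⟩ := (step v (hall v)).2
  rwa [alternatingCycle_eq hG hX (hK hY) hvX hvY]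

/-- With no vertices, `G` is its own factor with zero cycles, an even number. This guarantees an
alternating cycle to delete. -/
theorem IsOdd.nonempty (hodd : G.IsOdd) : Nonempty V := by
  by_contra hV
  rw [not_nonempty_iff] at hV
  have h := hodd G ⟨le_rfl, fun v => (hV.false v).elim, fun v => (hV.false v).elim⟩
  have hset : {c : Cycle V | G.IsDirectedCycle c} = ∅ := by
    refine Set.eq_empty_of_forall_notMem fun c hc => ?_
    obtain ⟨v, -⟩ := Cycle.exists_mem_of_ne_nil hc.1
    exact hV.false v
  rw [index, hset, Set.ncard_empty] at h
  exact absurd h (by decide)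

theorem not_isClosed_inducedBy_empty : ¬ (inducedBy (∅ : Set (Set (V × V)))).IsClosed := by
  intro h
  obtain ⟨c, hnil, -, hc⟩ := h (inducedBy ∅)
    ⟨le_rfl, fun v ⟨_, _, hX, _⟩ => hX.elim, fun v ⟨_, _, hX, _⟩ => hX.elim⟩
  obtain ⟨v, hv⟩ := Cycle.exists_mem_of_ne_nil hnil
  obtain ⟨_, _, _, hX, _⟩ := hc.exists_mem hv
  exact hX

end Digraph

theorem mainTheorem1 {V : Type*} [Finite V] (G : Digraph V)
    (hreg : G.IsDiregular 2)
    (hsix : ∀ X ∈ G.alternatingCycles, X.ncard = 6)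
    (hodd : G.IsOdd) :
    ¬ G.IsHamiltonian ↔
      ∃ K : Set (Set (V × V)), K ⊂ G.alternatingCycles ∧ K.Nonempty ∧
        (Digraph.inducedBy K).IsClosed := by
  constructor
  · intro hham
    obtain ⟨v⟩ := hodd.nonempty
    obtain ⟨w, hw, -⟩ := hreg.exists_ne_out v v
    obtain ⟨X, hX, -⟩ := hreg.exists_alternatingCycle_mem hw
    have hcl : (Digraph.inducedBy (G.alternatingCycles \ {X})).IsClosed := by
      by_contra hcl
      exact hham
        (Digraph.isHamiltonian_of_not_isClosed_inducedBy hreg hodd hX (hsix X hX) hcl)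
    -- Nonemptiness of the remaining set follows from its closedness: without arcs there is no
    -- cycle.
    refine ⟨_, Set.sdiff_singleton_ssubset.2 hX, ?_, hcl⟩
    rw [Set.nonempty_iff_ne_empty]
    intro h
    rw [h] at hcl
    exact Digraph.not_isClosed_inducedBy_empty hcl
  · rintro ⟨K, hK, -, hcl⟩ hham
    exact hK.ne (hham.eq_alternatingCycles_of_isClosed hreg hK.subset hcl)
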